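/- Let $I$ be a set and let $(n(i))_{i\in I}$ be an unbounded family of positive integers. Let $M=\prod_{i\in I}\mathbb M_{n(i)}$ (bounded families of matrices) act block-diagonally on $H=\bigoplus_{i\in I}\mathbb C^{n(i)}$ (and not on $L^2(M)$), so that the commutant is $M'\cong\ell^\infty(I)$, with $c\in\ell^\infty(I)$ acting on the block $\mathbb C^{n(i)}$ as the scalar $c_i$. For a family $Q=(Q_i)$ of positive definite matrices $Q_i\in\mathbb M_{n(i)}$ let $\varphi(x)=\sum_i\operatorname{Tr}(Q_ix_i)$ be the associated weight on $M$, let $\varphi^{-1}(T)=(\operatorname{Tr}(Q_i^{-1}T_{i,i}))_{i\in I}$ be the associated operator-valued weight from $\mathcal B(H)$ to $M'$, and let $\mathfrak n_{\varphi^{-1}}=\{\alpha\in\mathcal B(H):\|\varphi^{-1}(\alpha^*\alpha)\|<\infty\}$ with the $M'$-valued inner product $(\alpha|\beta)=\varphi^{-1}(\alpha^*\beta)$. For $\alpha\in\mathfrak n_{\varphi^{-1}}$ let $\hat\alpha:\ell^2(I)\to HS(H)$ be the bounded right $M'$-module map whose value at $\xi$ is the Hilbert--Schmidt operator with blocks $\hat\alpha(\xi)_{i,j}=\xi_j\,\alpha_{i,j}Q_j^{-1/2}$.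 For an $M'$-bimodule $V\subseteq HS(H)$ (a closed subspace with $M'VM'\subseteq V$) put $S=\{\alpha\in\mathfrak n_{\varphi^{-1}}:\hat\alpha(\ell^2(I))\subseteq V\}$, and let $e\in M\bar\otimes M^{\mathrm{op}}\subseteq\mathcal B(HS(H))$ be the orthogonal projection onto $V$. Call $S$ self-dual if every bounded right $M'$-module map $S\to M'$ has the form $\alpha\mapsto(\alpha_0|\alpha)$ for some $\alpha_0\in S$, and call $e$ integrable if $(\mathrm{id}\otimes\varphi^{\mathrm{op}})(e)<\infty$, that is, if there is a constant $C$ with $\varphi^{\mathrm{op}}((\omega_\xi\otimes\mathrm{id})(e))\le C\|\xi\|^2$ for all $\xi\in H$, where $\omega_\xi(x)=(\xi|x\xi)$. Then there are a family $Q$ of positive definite matrices such that $\varphi^{-1}$ is bounded, and even $\operatorname{Tr}(Q_i^{-1})=1$ for every $i$, and an $M'$-bimodule $V\subseteq HS(H)$ such that $S$ is self-dual, and moreover every bounded right $M'$-module map $t:\ell^2(I)\to V$ is of the form $t=\hat\alpha$ with $\alpha\in S$, but the projection $e$ onto $V$ is not integrable. -/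

import Mathlib

open scoped ComplexOrder MatrixOrder Matrix.Norms.L2Operator ENNReal InnerProductSpace

noncomputable section

namespace MatrixQG

/-- The Hilbert space `H = ⨁ᵢ ℂ^{n(i)}` (an `ℓ²`-direct sum). -/
abbrev Hil {I : Type*} (n : I → ℕ) : Type _ := lp (fun i => EuclideanSpace ℂ (Fin (n i))) 2

/-- The bounded operators on `H`. -/
abbrev BH {I : Type*} (n : I → ℕ) : Type _ := Hil n →L[ℂ] Hil n

/-- The index set of the standard orthonormal basis of `H`. -/
abbrev Idx {I : Type*} (n : I → ℕ) : Type _ := Σ i, Fin (n i)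

/-- The Hilbert space `HS(H)`.  A Hilbert--Schmidt operator is stored as its square-summable family
of columns, that is, its values on the standard orthonormal basis of `H`, so that the norm and inner
product are the Hilbert--Schmidt ones.  The operator itself is recovered by `hsOp` below. -/
abbrev HS {I : Type*} (n : I → ℕ) : Type _ := lp (fun _ : Idx n => Hil n) 2

/-- The Hilbert space `ℓ²(I)`: the GNS space of `M' ≅ ℓ^∞(I)` for the counting weight. -/
abbrev Ell2 (I : Type*) : Type _ := lp (fun _ : I => ℂ) 2

lemma hasSum_norm_sq {J : Type*} {E : J → Type*} [∀ j, NormedAddCommGroup (E j)] (f : lp E 2) :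
    HasSum (fun j => ‖f j‖ ^ (2 : ℝ)) (‖f‖ ^ (2 : ℝ)) := by
  simpa using lp.hasSum_norm (p := 2) (by norm_num) f

lemma hasSum_coord {I : Type*} {n : I → ℕ} (ξ : Hil n) :
    HasSum (fun x : Idx n => ‖ξ x.1 x.2‖ ^ (2 : ℝ)) (‖ξ‖ ^ (2 : ℝ)) := by
  have h1 := hasSum_norm_sq ξ
  have h2 : ∀ i, HasSum (fun k => ‖ξ i k‖ ^ (2 : ℝ)) (‖ξ i‖ ^ (2 : ℝ)) := by
    intro i
    have : ‖ξ i‖ ^ (2 : ℝ) = ∑ k, ‖ξ i k‖ ^ (2 : ℝ) := by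
      simp [EuclideanSpace.norm_sq_eq]
    rw [this]
    exact hasSum_fintype _
  have hs : Summable (fun x : Idx n => ‖ξ x.1 x.2‖ ^ (2 : ℝ)) := by
    rw [summable_sigma_of_nonneg (fun x => by positivity)]
    refine ⟨fun i => (h2 i).summable, ?_⟩
    simpa only [(h2 _).tsum_eq] using h1.summable
  have := hs.hasSum.sigma h2
  rw [← this.unique h1]
  exact hs.hasSum

lemma summable_and_bound {I : Type*} {n : I → ℕ} (v : HS n) (ξ : Hil n) :
    Summable (fun x : Idx n => ‖(ξ x.1 x.2) • v x‖) ∧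
      ∑' x : Idx n, ‖(ξ x.1 x.2) • v x‖ ≤ ‖v‖ * ‖ξ‖ := by
  have h := Real.summable_and_inner_le_Lp_mul_Lq_tsum_of_nonneg Real.HolderConjugate.two_two
    (f := fun x : Idx n => ‖ξ x.1 x.2‖) (g := fun x => ‖v x‖)
    (fun _ => norm_nonneg _) (fun _ => norm_nonneg _)
    (hasSum_coord ξ).summable (hasSum_norm_sq v).summable
  rw [(hasSum_coord ξ).tsum_eq, (hasSum_norm_sq v).tsum_eq] at h
  have e : ∀ a : ℝ, 0 ≤ a → (a ^ (2 : ℝ)) ^ (1 / (2 : ℝ)) = a := by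
    intro a ha
    rw [← Real.rpow_mul ha]; norm_num
  rw [e _ (norm_nonneg _), e _ (norm_nonneg _)] at h
  simp only [norm_smul]
  exact ⟨h.1, by linarith [h.2, mul_comm ‖ξ‖ ‖v‖]⟩

/-- The bounded operator on `H` with the given square-summable family of columns:
`ξ ↦ ∑ₓ ξₓ v(x)`. -/
def hsOp {I : Type*} {n : I → ℕ} (v : HS n) : BH n :=
  LinearMap.mkContinuous
    { toFun := fun ξ => ∑' x : Idx n, (ξ x.1 x.2) • v x
      map_add' := by
        intro ξ η
        rw [← (summable_and_bound v ξ).1.of_norm.tsum_add (summable_and_bound v η).1.of_norm]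
        simp [add_smul]
      map_smul' := by
        intro c ξ
        rw [RingHom.id_apply, ← (summable_and_bound v ξ).1.of_norm.tsum_const_smul c]
        simp [mul_smul] }
    ‖v‖ (fun ξ => (norm_tsum_le_tsum_norm (summable_and_bound v ξ).1).trans
      (summable_and_bound v ξ).2)

/-- The standard orthonormal basis of `H`: the `k`-th unit vector of the `i`-th block. -/
def basisVec {I : Type*} [DecidableEq I] (n : I → ℕ) (x : Idx n) : Hil n :=
  lp.single 2 x.1 (EuclideanSpace.single x.2 1)

/-- The `(i, j)` block of `T`, the matrix of a map `ℂ^{n(j)} → ℂ^{n(i)}`. -/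
def block {I : Type*} [DecidableEq I] {n : I → ℕ} (T : BH n) (i j : I) :
    Matrix (Fin (n i)) (Fin (n j)) ℂ :=
  Matrix.of fun k l => (T (basisVec n ⟨j, l⟩)) i k

/-- `M = ∏ᵢ 𝕄_{n(i)}` acting block-diagonally on `H`.  As `x` is a bounded operator, exactly the
families of matrices with uniformly bounded operator norm occur. -/
def alg {I : Type*} (n : I → ℕ) : Set (BH n) :=
  {x | ∃ a : ∀ i, Matrix (Fin (n i)) (Fin (n i)) ℂ,
    ∀ (ξ : Hil n) (i : I), (x ξ) i = Matrix.toEuclideanLin (a i) (ξ i)}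

/-- The commutant `M'` of `M` in `𝓑(H)`. -/
def comm {I : Type*} (n : I → ℕ) : Set (BH n) := Set.centralizer (alg n)

/-- `a` acts on each block `i` as multiplication by the scalar `c i`.  This is the identification of
an element `a` of `M'` with an element `c` of `ℓ^∞(I)`. -/
def ActsBy {I : Type*} {n : I → ℕ} (a : BH n) (c : I → ℂ) : Prop :=
  ∀ (ξ : Hil n) (i : I), (a ξ) i = c i • ξ i

/-- `V` is an `M'`-bimodule in `HS(H)`: a closed subspace with `a v b ∈ V` for `v ∈ V` and
`a, b ∈ M'`. -/
def IsHSBimodule {I : Type*} {n : I → ℕ} (V : Submodule ℂ (HS n)) : Prop :=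
  IsClosed (V : Set (HS n)) ∧
    ∀ v ∈ V, ∀ a ∈ comm n, ∀ b ∈ comm n, ∃ w ∈ V, hsOp w = a * hsOp v * b

/-! In what follows `Q = (Q_i)` is a family of positive definite matrices. -/

/-- The weight `φ(y) = Tr(Q y) = ∑ᵢ Tr(Q_i y_i)`, for `y = (y_i)` positive in `M`. -/
def weight {I : Type*} {n : I → ℕ} (Q : ∀ i, Matrix (Fin (n i)) (Fin (n i)) ℂ)
    (y : ∀ i, Matrix (Fin (n i)) (Fin (n i)) ℂ) : ℝ≥0∞ :=
  ∑' i, ENNReal.ofReal (Q i * y i).trace.re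

/-- The operator-valued weight `φ⁻¹` from `𝓑(H)` to `M' ≅ ℓ^∞(I)`, namely
`φ⁻¹(T) = (Tr(Q_i⁻¹ T_{i,i}))_i`.  For `T ≥ 0` the value is a non-negative function on `I`, hence an
element of the extended positive part of `ℓ^∞(I)`; it is finite when this function is bounded. -/
def invWeight {I : Type*} [DecidableEq I] {n : I → ℕ}
    (Q : ∀ i, Matrix (Fin (n i)) (Fin (n i)) ℂ) (T : BH n) (i : I) : ℂ :=
  ((Q i)⁻¹ * block T i i).trace

/-- `φ⁻¹` is bounded. -/
def InvWeightBounded {I : Type*} [DecidableEq I] {n : I → ℕ}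
    (Q : ∀ i, Matrix (Fin (n i)) (Fin (n i)) ℂ) : Prop :=
  ∃ C : ℝ, ∀ T : BH n, T.IsPositive → ∀ i, ‖invWeight Q T i‖ ≤ C * ‖T‖

/-- The `M'`-valued inner product `(α|β) = φ⁻¹(α* β)`, as a function on `I`. -/
def modInner {I : Type*} [DecidableEq I] {n : I → ℕ}
    (Q : ∀ i, Matrix (Fin (n i)) (Fin (n i)) ℂ) (α β : BH n) : I → ℂ :=
  invWeight Q (ContinuousLinearMap.adjoint α * β)

/-- `𝔫_{φ⁻¹} = {α : ‖φ⁻¹(α* α)‖ < ∞}`. -/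
def nInv {I : Type*} [DecidableEq I] {n : I → ℕ}
    (Q : ∀ i, Matrix (Fin (n i)) (Fin (n i)) ℂ) : Set (BH n) :=
  {α | BddAbove (Set.range fun i => ‖modInner Q α α i‖)}

/-- The square `‖(α|α)‖ = ‖φ⁻¹(α* α)‖` of the module norm of `α ∈ 𝔫_{φ⁻¹}`. -/
def modNormSq {I : Type*} [DecidableEq I] {n : I → ℕ}
    (Q : ∀ i, Matrix (Fin (n i)) (Fin (n i)) ℂ) (α : BH n) : ℝ :=
  ⨆ i, ‖modInner Q α α i‖

/-- The columns of the Hilbert--Schmidt operator `α̂(ξ) = α ξ Q^{-1/2}` for `ξ ∈ ℓ²(I)`, where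
`ξ` acts on `H` as multiplication by `ξ_j` on the block `j`. -/
def hatCol {I : Type*} [DecidableEq I] {n : I → ℕ}
    (Q : ∀ i, Matrix (Fin (n i)) (Fin (n i)) ℂ) (α : BH n) (ξ : Ell2 I) (x : Idx n) : Hil n :=
  ξ x.1 • α (lp.single 2 x.1
    (Matrix.toEuclideanLin (CFC.sqrt (Q x.1)⁻¹) (EuclideanSpace.single x.2 1)))

/-- `S = {α ∈ 𝔫_{φ⁻¹} : Im(α̂) ⊆ V}`. -/
def modS {I : Type*} [DecidableEq I] {n : I → ℕ}
    (Q : ∀ i, Matrix (Fin (n i)) (Fin (n i)) ℂ) (V : Submodule ℂ (HS n)) : Set (BH n) :=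
  {α | α ∈ nInv Q ∧ ∀ ξ : Ell2 I, ∃ v ∈ V, ∀ x, v x = hatCol Q α ξ x}

/-- `S` is self-dual as an inner product module over `M'`: each bounded right `M'`-module map
`F : S → M'` is of the form `α ↦ (α₀|α)` for some `α₀ ∈ S`.  (Only the values of `F` on the right
`M'`-module `S` are constrained.  Complex homogeneity is the case of scalar `a`.) -/
def IsSelfDual {I : Type*} [DecidableEq I] {n : I → ℕ}
    (Q : ∀ i, Matrix (Fin (n i)) (Fin (n i)) ℂ) (S : Set (BH n)) : Prop :=
  ∀ F : BH n → BH n,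
    (∀ α ∈ S, F α ∈ comm n) →
    (∀ α ∈ S, ∀ β ∈ S, F (α + β) = F α + F β) →
    (∀ α ∈ S, ∀ a ∈ comm n, F (α * a) = F α * a) →
    (∃ C : ℝ, ∀ α ∈ S, ‖F α‖ ^ 2 ≤ C * modNormSq Q α) →
    ∃ α₀ ∈ S, ∀ α ∈ S, ActsBy (F α) (modInner Q α₀ α)

/-- `t ∈ 𝓑_{M'}(ℓ²(I), HS(H))`: the bounded operator `t` satisfies `t(ξ·a) = t(ξ) a` for `a ∈ M'`,
where `a` acts on `ℓ²(I)` by pointwise multiplication and on `HS(H)` by right composition. -/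
def IsModuleMap {I : Type*} {n : I → ℕ} (t : Ell2 I →L[ℂ] HS n) : Prop :=
  ∀ a ∈ comm n, ∀ c : I → ℂ, ActsBy a c →
    ∀ ξ η : Ell2 I, (∀ i, η i = ξ i * c i) → hsOp (t η) = hsOp (t ξ) * a

/-- The slice `y = (ω_ξ ⊗ id)(e)` in `M^op`, regarded as a family of matrices, for `e` in
`M ⊗̄ M^op ⊆ 𝓑(H ⊗ H̄) = 𝓑(HS(H))` and the vector functional `ω_ξ`.  The element `x^op` acts on `H̄`
as the transpose of `x`, so `⟨f', y f⟩ = ⟨ξ ⊗ f̄, e (ξ ⊗ f̄')⟩` for vectors `f, f'` of `H`; here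
`ξ ⊗ f̄`, for a basis vector `f`, is the rank one operator whose only non-zero column is `ξ`. -/
def slice {I : Type*} [DecidableEq I] {n : I → ℕ} (e : HS n →L[ℂ] HS n) (ξ : Hil n) (i : I) :
    Matrix (Fin (n i)) (Fin (n i)) ℂ :=
  Matrix.of fun k' k =>
    ⟪(lp.single 2 (⟨i, k⟩ : Idx n) ξ : HS n), e (lp.single 2 (⟨i, k'⟩ : Idx n) ξ)⟫_ℂ

/-- The projection `e` is integrable: `(id ⊗ φ^op)(e) < ∞`, that is, the element
`ω ↦ φ^op((ω ⊗ id)(e))` of the extended positive part of `M` is bounded.  Since it is countably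
additive in `ω`, it suffices to bound it on vector functionals. -/
def IsIntegrable {I : Type*} [DecidableEq I] {n : I → ℕ}
    (Q : ∀ i, Matrix (Fin (n i)) (Fin (n i)) ℂ) (e : HS n →L[ℂ] HS n) : Prop :=
  ∃ C : ℝ, ∀ ξ : Hil n, weight Q (slice e ξ) ≤ ENNReal.ofReal (C * ‖ξ‖ ^ 2)

end MatrixQG

end

/-! On a block of size `m`, take `Q⁻¹` diagonal with eigenvalues `p₀ = m/(2m-1)` and `p_l =
1/(2m-1)` for `l ≠ 0`. Let the block of `V` consist of the matrices with `0`-th column `c` and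
`l`-th column `√p_l c_l e₀` for `l ≠ 0`, where `c ∈ ℂᵐ` is arbitrary. The Hilbert–Schmidt norm of
such a matrix lies between `‖c‖` and `√2 ‖c‖` (`sum_inner_col`). Multiplying by `Q^{1/2}` cancels
the factors `√p_l`: one column `p₀^{-1/2} c` and one row with entries `c_l` remain, of operator norm
at most `3‖c‖` (`norm_blockOp_le`).

Hence `S` is exactly the set of bounded families `(c_j)`. Every bounded module map into `V` gives
such a family (`exists_mem_modS_of_isModuleMap`), and self-duality reduces to the Riesz theorem on
each block with uniform constants (`isSelfDual_modS_colSpace`).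

Integrability fails because the matrix unit `e₀ e_k^*` has a projection onto `V` of squared norm at
least `p_k/4`, while `φ` weights it by `1/p_k`. Each `k ≠ 0` thus contributes at least `1/4`, and
the sum over `k` grows with `m` (`not_isIntegrable_of_range_eq_colSpace`). -/

noncomputable section

namespace MatrixQG

/-! ### Norm estimates on a single block -/

section Block

variable {m : ℕ} [NeZero m]

/-- The eigenvalues of `Q⁻¹` on a block of size `m`: a probability vector whose first entry is at
least `1 / 2`. -/
def prob (l : Fin m) : ℝ := if l = 0 then m / (2 * m - 1) else 1 / (2 * m - 1)

lemma two_mul_sub_one_pos (m : ℕ) [NeZero m] : (0 : ℝ) < 2 * m - 1 := by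
  have : (1 : ℝ) ≤ m := by exact_mod_cast NeZero.one_le
  linarith

lemma prob_pos (l : Fin m) : 0 < prob l := by
  have h := two_mul_sub_one_pos m
  have : (1 : ℝ) ≤ m := by exact_mod_cast NeZero.one_le
  unfold prob
  split_ifs <;> positivity

lemma sum_prob : ∑ l : Fin m, prob l = 1 := by
  have h := two_mul_sub_one_pos m
  have e : ∀ l : Fin m, prob l =
      1 / (2 * m - 1) + if l = 0 then ((m : ℝ) - 1) / (2 * m - 1) else 0 := by
    intro l
    unfold prob
    split_ifs
    · field_simp; ring
    · ring
  rw [Finset.sum_congr rfl fun l _ => e l, Finset.sum_add_distrib]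
  simp only [Finset.sum_const, Finset.card_univ, Fintype.card_fin, nsmul_eq_mul,
    Finset.sum_ite_eq', Finset.mem_univ, if_true]
  rw [mul_one_div, ← add_div, div_eq_one_iff_eq h.ne']
  ring

lemma prob_le_one (l : Fin m) : prob l ≤ 1 := by
  rw [← sum_prob (m := m)]
  exact Finset.single_le_sum (fun k _ => (prob_pos k).le) (Finset.mem_univ l)

/-- The full column `c` gets rescaled by `p₀^{-1/2}`, which must stay bounded independently of `m`.
-/
lemma inv_prob_zero_le : (prob (0 : Fin m))⁻¹ ≤ 2 := by
  have h := two_mul_sub_one_pos m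
  have : (1 : ℝ) ≤ m := by exact_mod_cast NeZero.one_le
  simp only [prob, if_true, inv_div]
  rw [div_le_iff₀ (by linarith)]
  linarith

/-- The `l`-th column of the matrix in the block bimodule with `0`-th column `c`. -/
def col (l : Fin m) : EuclideanSpace ℂ (Fin m) →L[ℂ] EuclideanSpace ℂ (Fin m) :=
  if l = 0 then ContinuousLinearMap.id ℂ _
  else ((√(prob l) : ℂ) • (EuclideanSpace.proj l : EuclideanSpace ℂ (Fin m) →L[ℂ] ℂ)).smulRight
    (EuclideanSpace.single 0 1)

@[simp]
lemma col_zero (c : EuclideanSpace ℂ (Fin m)) : col 0 c = c := by simp [col]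

lemma col_of_ne {l : Fin m} (hl : l ≠ 0) (c : EuclideanSpace ℂ (Fin m)) :
    col l c = (√(prob l) * c l : ℂ) • EuclideanSpace.single 0 1 := by
  simp [col, hl]

/-- The coefficients of the Gram form `∑ₗ ⟪col l c, col l d⟫`. -/
def gramCoeff (l : Fin m) : ℝ := if l = 0 then 1 else 1 + prob l

lemma one_le_gramCoeff (l : Fin m) : 1 ≤ gramCoeff l := by
  unfold gramCoeff
  split_ifs
  · rfl
  · linarith [prob_pos l]

lemma gramCoeff_le_two (l : Fin m) : gramCoeff l ≤ 2 := by
  unfold gramCoeff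
  split_ifs
  · norm_num
  · linarith [prob_le_one l]

lemma ofReal_sqrt_mul_self {r : ℝ} (hr : 0 ≤ r) : ((√r : ℝ) : ℂ) * (√r : ℝ) = r := by
  rw [← Complex.ofReal_mul, Real.mul_self_sqrt hr]

/-- Column `0` contributes all of `⟪c, d⟫` and column `l ≠ 0` only a multiple of the `l`-th
coordinate term, so the Gram form is diagonal. -/
lemma sum_inner_col (c d : EuclideanSpace ℂ (Fin m)) :
    ∑ l, ⟪col l c, col l d⟫_ℂ = ∑ l, (gramCoeff l : ℂ) * (starRingEnd ℂ (c l) * d l) := by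
  -- The whole of `⟪c, d⟫` is booked at `l = 0`; the subtracted coordinate terms cancel it after
  -- summation.
  have e : ∀ l : Fin m, ⟪col l c, col l d⟫_ℂ =
      (gramCoeff l : ℂ) * (starRingEnd ℂ (c l) * d l) - starRingEnd ℂ (c l) * d l +
        if l = 0 then ⟪c, d⟫_ℂ else 0 := by
    intro l
    by_cases hl : l = 0
    · subst hl
      simp [gramCoeff]
    · have h2 := ofReal_sqrt_mul_self (prob_pos l).le
      simp only [col_of_ne hl, inner_smul_left, inner_smul_right, gramCoeff, hl, if_false,
        map_mul, Complex.conj_ofReal, inner_self_eq_norm_sq_to_K, PiLp.norm_single]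
      push_cast
      simp only [← h2]
      simp
      ring
  rw [Finset.sum_congr rfl fun l _ => e l, Finset.sum_add_distrib, Finset.sum_sub_distrib]
  have : ⟪c, d⟫_ℂ = ∑ l, starRingEnd ℂ (c l) * d l := by
    rw [PiLp.inner_apply]
    refine Finset.sum_congr rfl fun l _ => ?_
    simp [mul_comm]
  simp [this]

lemma sum_norm_col_sq_le (c : EuclideanSpace ℂ (Fin m)) :
    ∑ l, ‖col l c‖ ^ 2 ≤ 2 * ‖c‖ ^ 2 := by
  have h : ((∑ l, ‖col l c‖ ^ 2 : ℝ) : ℂ) = ((∑ l, gramCoeff l * ‖c l‖ ^ 2 : ℝ) : ℂ) := by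
    have := sum_inner_col c c
    simp only [inner_self_eq_norm_sq_to_K, Complex.conj_mul'] at this
    push_cast
    exact this
  rw [Complex.ofReal_inj.1 h, EuclideanSpace.norm_sq_eq, Finset.mul_sum]
  gcongr
  exact gramCoeff_le_two _

/-- The matrix with columns `prob l ^ (-1/2) • col l c`. -/
def blockOp (c : EuclideanSpace ℂ (Fin m)) :
    EuclideanSpace ℂ (Fin m) →L[ℂ] EuclideanSpace ℂ (Fin m) :=
  ∑ l, ((√(prob l)⁻¹ : ℂ) • (EuclideanSpace.proj l : EuclideanSpace ℂ (Fin m) →L[ℂ] ℂ)).smulRight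
    (col l c)

lemma blockOp_apply (c η : EuclideanSpace ℂ (Fin m)) :
    blockOp c η = ∑ l, (√(prob l)⁻¹ * η l : ℂ) • col l c := by
  simp [blockOp]

lemma blockOp_single (c : EuclideanSpace ℂ (Fin m)) (l : Fin m) :
    blockOp c (EuclideanSpace.single l 1) = (√(prob l)⁻¹ : ℂ) • col l c := by
  rw [blockOp_apply, Finset.sum_eq_single l]
  · simp
  · intro b _ hb
    simp [hb]
  · simp

lemma norm_sqrt_inv_mul_col_le {l : Fin m} (hl : l ≠ 0) (c η : EuclideanSpace ℂ (Fin m)) :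
    ‖(√(prob l)⁻¹ * η l : ℂ) • col l c‖ ≤ ‖c l‖ * ‖η l‖ := by
  have h := prob_pos l
  have h2 : √(prob l)⁻¹ * √(prob l) = 1 := by
    rw [← Real.sqrt_mul (by positivity), inv_mul_cancel₀ h.ne', Real.sqrt_one]
  rw [col_of_ne hl, norm_smul, norm_smul, norm_mul, norm_mul, PiLp.norm_single,
    Complex.norm_of_nonneg (by positivity), Complex.norm_of_nonneg (by positivity), norm_one]
  refine le_of_eq ?_
  linear_combination ‖c l‖ * ‖η l‖ * h2

/-- The `0`-th column costs at most `2‖c‖`. The other columns are multiples of `e₀`, hence form a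
single row, which Cauchy–Schwarz bounds by `‖c‖` whatever `m` is. -/
lemma norm_blockOp_le (c : EuclideanSpace ℂ (Fin m)) : ‖blockOp c‖ ≤ 3 * ‖c‖ := by
  refine ContinuousLinearMap.opNorm_le_bound _ (by positivity) fun η => ?_
  rw [blockOp_apply, ← Finset.add_sum_erase _ _ (Finset.mem_univ (0 : Fin m))]
  have h0 : ‖(√(prob (0 : Fin m))⁻¹ * η 0 : ℂ) • col 0 c‖ ≤ 2 * ‖c‖ * ‖η‖ := by
    have hq : √(prob (0 : Fin m))⁻¹ ≤ 2 := by
      rw [Real.sqrt_le_left (by norm_num)]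
      linarith [inv_prob_zero_le (m := m)]
    rw [norm_smul, norm_mul, Complex.norm_of_nonneg (by positivity), col_zero]
    calc √(prob (0 : Fin m))⁻¹ * ‖η 0‖ * ‖c‖ ≤ 2 * ‖η‖ * ‖c‖ := by
          gcongr
          exact PiLp.norm_apply_le η 0
      _ = _ := by ring
  have h1 : ‖∑ l ∈ Finset.univ.erase (0 : Fin m), (√(prob l)⁻¹ * η l : ℂ) • col l c‖ ≤
      ‖c‖ * ‖η‖ := by
    calc _ ≤ ∑ l ∈ Finset.univ.erase (0 : Fin m), ‖c l‖ * ‖η l‖ :=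
          (norm_sum_le _ _).trans <| Finset.sum_le_sum fun l hl =>
            norm_sqrt_inv_mul_col_le (Finset.ne_of_mem_erase hl) c η
      _ ≤ ∑ l, ‖c l‖ * ‖η l‖ :=
          Finset.sum_le_univ_sum_of_nonneg fun l => by positivity
      _ ≤ √(∑ l, ‖c l‖ ^ 2) * √(∑ l, ‖η l‖ ^ 2) := Real.sum_mul_le_sqrt_mul_sqrt _ _ _
      _ = _ := by rw [← EuclideanSpace.norm_eq, ← EuclideanSpace.norm_eq]
  calc _ ≤ 2 * ‖c‖ * ‖η‖ + ‖c‖ * ‖η‖ := (norm_add_le _ _).trans (add_le_add h0 h1)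
    _ = _ := by ring

end Block

lemma hsOp_apply {I : Type*} {n : I → ℕ} (v : HS n) (ξ : Hil n) :
    hsOp v ξ = ∑' x : Idx n, (ξ x.1 x.2) • v x := rfl

/-! ### Coordinates in the standard basis -/

section Basis

variable {I : Type*} [DecidableEq I] {n : I → ℕ}

lemma inner_basisVec (x : Idx n) (ξ : Hil n) : ⟪basisVec n x, ξ⟫_ℂ = ξ x.1 x.2 := by
  rw [basisVec, lp.inner_single_left, EuclideanSpace.inner_single_left]
  simp

@[simp]
lemma norm_basisVec (x : Idx n) : ‖basisVec n x‖ = 1 := by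
  rw [basisVec, lp.norm_single (by norm_num), PiLp.norm_single, norm_one]

lemma basisVec_apply_same (i : I) (k l : Fin (n i)) :
    basisVec n ⟨i, k⟩ i l = if l = k then 1 else 0 := by
  simp [basisVec]

lemma basisVec_apply_of_ne {i j : I} (h : j ≠ i) (k : Fin (n i)) : basisVec n ⟨i, k⟩ j = 0 := by
  simp [basisVec, Pi.single_eq_of_ne h]

lemma basisVec_apply (x y : Idx n) : basisVec n x y.1 y.2 = if y = x then 1 else 0 := by
  obtain ⟨i, k⟩ := x
  obtain ⟨j, l⟩ := y
  by_cases h : j = i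
  · subst h
    simp [basisVec_apply_same]
  · simp [basisVec_apply_of_ne h, h]

lemma ext_basisVec {S T : BH n} (h : ∀ x, S (basisVec n x) = T (basisVec n x)) : S = T := by
  refine lp.ext_continuousLinearMap (by norm_num) fun i => ?_
  refine ContinuousLinearMap.coe_injective ?_
  refine (EuclideanSpace.basisFun (Fin (n i)) ℂ).toBasis.ext fun k => ?_
  simpa [basisVec] using h ⟨i, k⟩

lemma hsOp_basisVec (v : HS n) (x : Idx n) : hsOp v (basisVec n x) = v x := by
  rw [hsOp_apply, tsum_eq_single x]
  · simp [basisVec_apply]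
  · intro y hy
    simp [basisVec_apply, hy]

end Basis

/-! ### The commutant as scalars on blocks -/

section Commutant

variable {I : Type*} {n : I → ℕ}

lemma ActsBy.mem_comm {a : BH n} {c : I → ℂ} (h : ActsBy a c) : a ∈ comm n := by
  rintro x ⟨A, hA⟩
  ext ξ i : 3
  simp only [mul_apply_eq_comp, hA, h _ i, map_smul]

variable [DecidableEq I]

lemma ActsBy.apply_single {a : BH n} {c : I → ℂ} (h : ActsBy a c) (j : I)
    (ξ : EuclideanSpace ℂ (Fin (n j))) : a (lp.single 2 j ξ) = c j • lp.single 2 j ξ := by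
  ext i : 2
  rw [h]
  by_cases hi : i = j
  · subst hi; simp
  · simp [Pi.single_eq_of_ne hi]

/-- The matrix unit of the block `i` with entry `1` at `(k, l)`. -/
def unitOp (i : I) (k l : Fin (n i)) : BH n :=
  (innerSL ℂ (basisVec n ⟨i, l⟩)).smulRight (basisVec n ⟨i, k⟩)

lemma unitOp_apply (i : I) (k l : Fin (n i)) (ξ : Hil n) :
    unitOp i k l ξ = ξ i l • basisVec n ⟨i, k⟩ := by
  simp only [unitOp, ContinuousLinearMap.smulRight_apply, innerSL_apply_apply, inner_basisVec]

lemma unitOp_mem_alg (i : I) (k l : Fin (n i)) : unitOp i k l ∈ alg n := by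
  refine ⟨Pi.single i (Matrix.single k l 1), fun ξ j => ?_⟩
  rw [unitOp_apply]
  by_cases h : j = i
  · subst h
    ext r
    simp [basisVec_apply_same, Matrix.single_mulVec, Function.update_apply]
  · simp [basisVec_apply_of_ne h, Pi.single_eq_of_ne h]

/-- Commuting with the matrix unit at `(0, k)` moves the `k`-th coordinate of `a ξ` to position `0`,
where the scalar is read off. -/
lemma exists_actsBy_of_mem_comm [∀ i, NeZero (n i)] {a : BH n} (ha : a ∈ comm n) :
    ActsBy a fun i => a (basisVec n ⟨i, 0⟩) i 0 := by
  intro ξ i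
  ext k
  have h := congrArg (fun T : BH n => T ξ i 0) (ha _ (unitOp_mem_alg i 0 k))
  simpa [unitOp_apply, basisVec_apply_same, mul_comm] using h

lemma norm_coeff_le [∀ i, NeZero (n i)] (a : BH n) (i : I) :
    ‖a (basisVec n ⟨i, 0⟩) i 0‖ ≤ ‖a‖ := by
  calc _ ≤ ‖a (basisVec n ⟨i, 0⟩) i‖ := PiLp.norm_apply_le _ _
    _ ≤ ‖a (basisVec n ⟨i, 0⟩)‖ := lp.norm_apply_le_norm (by norm_num) _ _
    _ ≤ ‖a‖ := by simpa using a.le_opNorm (basisVec n ⟨i, 0⟩)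

/-- The projection onto the block `j`. -/
def blockProj (n : I → ℕ) (j : I) : BH n :=
  (lp.singleContinuousLinearMap ℂ (fun i => EuclideanSpace ℂ (Fin (n i))) 2 j).comp
    (lp.evalCLM ℂ (fun i => EuclideanSpace ℂ (Fin (n i))) 2 j)

lemma blockProj_apply (j : I) (ξ : Hil n) : blockProj n j ξ = lp.single 2 j (ξ j) := rfl

lemma actsBy_blockProj (j : I) : ActsBy (blockProj n j) (Pi.single j 1) := by
  intro ξ i
  rw [blockProj_apply]
  by_cases h : i = j
  · subst h; simp
  · simp [Pi.single_eq_of_ne h]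

lemma blockProj_basisVec_same (j : I) (l : Fin (n j)) :
    blockProj n j (basisVec n ⟨j, l⟩) = basisVec n ⟨j, l⟩ := by
  simp [blockProj_apply, basisVec]

lemma blockProj_basisVec_of_ne {i j : I} (h : i ≠ j) (l : Fin (n i)) :
    blockProj n j (basisVec n ⟨i, l⟩) = 0 := by
  simp [blockProj_apply, basisVec_apply_of_ne h.symm]

end Commutant

/-! ### The weight and its inverse for the chosen densities -/

section Weight

variable {I : Type*} {n : I → ℕ} [∀ i, NeZero (n i)]

/-- The density matrices with eigenvalues `(prob l)⁻¹`. -/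
def density (n : I → ℕ) [∀ i, NeZero (n i)] (i : I) : Matrix (Fin (n i)) (Fin (n i)) ℂ :=
  Matrix.diagonal fun l => ((prob l)⁻¹ : ℂ)

lemma ofReal_prob_ne_zero {m : ℕ} [NeZero m] (l : Fin m) : (prob l : ℂ) ≠ 0 :=
  Complex.ofReal_ne_zero.2 (prob_pos l).ne'

lemma density_inv (i : I) : (density n i)⁻¹ = Matrix.diagonal fun l => (prob l : ℂ) := by
  refine Matrix.inv_eq_right_inv ?_
  rw [density, Matrix.diagonal_mul_diagonal, ← Matrix.diagonal_one]
  congr 1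
  ext l
  exact inv_mul_cancel₀ (ofReal_prob_ne_zero l)

lemma density_posDef (i : I) : (density n i).PosDef := by
  rw [density, Matrix.posDef_diagonal_iff]
  intro l
  rw [← Complex.ofReal_inv]
  exact Complex.zero_lt_real.2 (inv_pos.2 (prob_pos l))

lemma trace_density_inv (i : I) : ((density n i)⁻¹).trace = 1 := by
  rw [density_inv, Matrix.trace_diagonal, ← Complex.ofReal_sum, sum_prob, Complex.ofReal_one]

lemma sqrt_density_inv (i : I) :
    CFC.sqrt (density n i)⁻¹ = Matrix.diagonal fun l => (√(prob l) : ℂ) := by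
  refine CFC.sqrt_unique ?_ ?_
  · rw [density_inv, Matrix.diagonal_mul_diagonal]
    congr 1
    ext l
    exact ofReal_sqrt_mul_self (prob_pos l).le
  · rw [Matrix.nonneg_iff_posSemidef, Matrix.posSemidef_diagonal_iff]
    intro l
    exact Complex.zero_le_real.2 (Real.sqrt_nonneg _)

variable [DecidableEq I]

lemma hatCol_density (α : BH n) (ξ : Ell2 I) (j : I) (l : Fin (n j)) :
    hatCol (density n) α ξ ⟨j, l⟩ = (ξ j * √(prob l) : ℂ) • α (basisVec n ⟨j, l⟩) := by
  have : Matrix.toEuclideanLin (Matrix.diagonal fun l : Fin (n j) => (√(prob l) : ℂ))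
      (EuclideanSpace.single l 1) = (√(prob l) : ℂ) • EuclideanSpace.single l 1 := by
    ext k
    by_cases h : k = l
    · subst h; simp [Matrix.toLpLin_apply]
    · simp [Matrix.toLpLin_apply, h]
  rw [hatCol, sqrt_density_inv, this, lp.single_smul, map_smul, smul_smul, basisVec]

lemma invWeight_density (T : BH n) (i : I) :
    invWeight (density n) T i =
      ∑ l, (prob l : ℂ) * ⟪basisVec n ⟨i, l⟩, T (basisVec n ⟨i, l⟩)⟫_ℂ := by
  simp [invWeight, density_inv, Matrix.trace, Matrix.diagonal_mul, block, inner_basisVec]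

lemma norm_invWeight_density_le (T : BH n) (i : I) : ‖invWeight (density n) T i‖ ≤ ‖T‖ := by
  rw [invWeight_density]
  calc _ ≤ ∑ l : Fin (n i), prob l * ‖T‖ := by
        refine (norm_sum_le _ _).trans (Finset.sum_le_sum fun l _ => ?_)
        rw [norm_mul, Complex.norm_of_nonneg (prob_pos l).le]
        refine mul_le_mul_of_nonneg_left ?_ (prob_pos l).le
        refine (norm_inner_le_norm _ _).trans ?_
        simpa using T.le_opNorm (basisVec n ⟨i, l⟩)
    _ = ‖T‖ := by rw [← Finset.sum_mul, sum_prob, one_mul]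

lemma modInner_density (α β : BH n) (i : I) :
    modInner (density n) α β i =
      ∑ l, (prob l : ℂ) * ⟪α (basisVec n ⟨i, l⟩), β (basisVec n ⟨i, l⟩)⟫_ℂ := by
  simp [modInner, invWeight_density, ContinuousLinearMap.adjoint_inner_right]

/-- Since `Q_i⁻¹` has trace one, membership in `𝔫_{φ⁻¹}` imposes no condition. -/
lemma mem_nInv_density (α : BH n) : α ∈ nInv (density n) := by
  refine ⟨‖ContinuousLinearMap.adjoint α * α‖, ?_⟩
  rintro _ ⟨i, rfl⟩
  exact norm_invWeight_density_le _ i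

end Weight

variable {I : Type*} {n : I → ℕ} [∀ i, NeZero (n i)]

/-! ### Bounded operators from bounded families of columns -/

section DiagOp

/-- The block-diagonal operator with blocks `blockOp (c i)`. -/
def diagOp (c : lp (fun i => EuclideanSpace ℂ (Fin (n i))) ∞) : BH n :=
  lp.mapCLM 2 (fun i => blockOp (c i)) (K := 3 * ‖c‖) (by positivity) fun i =>
    (norm_blockOp_le _).trans (by gcongr; exact lp.norm_apply_le_norm (by simp) c i)

lemma diagOp_apply (c : lp (fun i => EuclideanSpace ℂ (Fin (n i))) ∞) (ξ : Hil n) (i : I) :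
    diagOp c ξ i = blockOp (c i) (ξ i) := by
  simp [diagOp]

variable [DecidableEq I]

lemma diagOp_basisVec (c : lp (fun i => EuclideanSpace ℂ (Fin (n i))) ∞) (j : I) (l : Fin (n j)) :
    diagOp c (basisVec n ⟨j, l⟩) = (√(prob l)⁻¹ : ℂ) • lp.single 2 j (col l (c j)) := by
  ext i : 2
  rw [diagOp_apply]
  by_cases h : i = j
  · subst h
    simp [basisVec, blockOp_single]
  · simp [basisVec_apply_of_ne h, Pi.single_eq_of_ne h]

lemma diagOp_add (c d : lp (fun i => EuclideanSpace ℂ (Fin (n i))) ∞) :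
    diagOp (c + d) = diagOp c + diagOp d :=
  ext_basisVec fun ⟨j, l⟩ => by
    simp [diagOp_basisVec]

/-- Scalars are written as right multiplication by `M'`, the only homogeneity available for a module
map in `IsSelfDual`. -/
lemma diagOp_smul (z : ℂ) (c : lp (fun i => EuclideanSpace ℂ (Fin (n i))) ∞) :
    diagOp (z • c) = diagOp c * z • (1 : BH n) :=
  ext_basisVec fun ⟨j, l⟩ => by
    simp [diagOp_basisVec, smul_smul, mul_comm]

lemma diagOp_mul_blockProj (c : lp (fun i => EuclideanSpace ℂ (Fin (n i))) ∞) (j : I) :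
    diagOp c * blockProj n j = diagOp (lp.single ∞ j (c j)) :=
  ext_basisVec fun ⟨i, l⟩ => by
    rw [mul_apply_eq_comp]
    by_cases h : i = j
    · subst h
      simp [blockProj_basisVec_same, diagOp_basisVec]
    · simp [blockProj_basisVec_of_ne h, diagOp_basisVec, Pi.single_eq_of_ne h]

lemma ofReal_sqrt_mul_sqrt_inv {m : ℕ} [NeZero m] (l : Fin m) :
    (√(prob l) : ℂ) * √(prob l)⁻¹ = 1 := by
  have h := prob_pos l
  rw [← Complex.ofReal_mul, ← Real.sqrt_mul h.le, mul_inv_cancel₀ h.ne', Real.sqrt_one,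
    Complex.ofReal_one]

lemma hatCol_diagOp (c : lp (fun i => EuclideanSpace ℂ (Fin (n i))) ∞) (ξ : Ell2 I) (j : I)
    (l : Fin (n j)) :
    hatCol (density n) (diagOp c) ξ ⟨j, l⟩ = ξ j • lp.single 2 j (col l (c j)) := by
  rw [hatCol_density, diagOp_basisVec, smul_smul, mul_assoc, ofReal_sqrt_mul_sqrt_inv, mul_one]

lemma modInner_diagOp (c d : lp (fun i => EuclideanSpace ℂ (Fin (n i))) ∞) (i : I) :
    modInner (density n) (diagOp c) (diagOp d) i = ∑ l, ⟪col l (c i), col l (d i)⟫_ℂ := by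
  rw [modInner_density]
  refine Finset.sum_congr rfl fun l _ => ?_
  rw [diagOp_basisVec, diagOp_basisVec, inner_smul_left, inner_smul_right, lp.inner_single_left,
    lp.single_apply_self, Complex.conj_ofReal, ← mul_assoc, ← mul_assoc, mul_assoc (prob l : ℂ),
    ofReal_sqrt_mul_self (inv_pos.2 (prob_pos l)).le, Complex.ofReal_inv,
    mul_inv_cancel₀ (ofReal_prob_ne_zero l), one_mul]

lemma modNormSq_diagOp_le (c : lp (fun i => EuclideanSpace ℂ (Fin (n i))) ∞) :
    modNormSq (density n) (diagOp c) ≤ 2 * ‖c‖ ^ 2 := by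
  refine Real.iSup_le (fun i => ?_) (by positivity)
  rw [modInner_diagOp]
  calc _ ≤ ∑ l, ‖col l (c i)‖ ^ 2 := (norm_sum_le _ _).trans <| Finset.sum_le_sum fun l _ => by
        rw [sq]; exact norm_inner_le_norm _ _
    _ ≤ 2 * ‖c i‖ ^ 2 := sum_norm_col_sq_le _
    _ ≤ _ := by gcongr; exact lp.norm_apply_le_norm (by simp) c i

lemma memℓp_hatCol_diagOp (c : lp (fun i => EuclideanSpace ℂ (Fin (n i))) ∞) (ξ : Ell2 I) :
    Memℓp (hatCol (density n) (diagOp c) ξ) 2 := by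
  have hfib : ∀ i, HasSum
      (fun l : Fin (n i) => ‖hatCol (density n) (diagOp c) ξ ⟨i, l⟩‖ ^ (2 : ℝ≥0∞).toReal)
      (‖ξ i‖ ^ 2 * ∑ l, ‖col l (c i)‖ ^ 2) := by
    intro i
    rw [Finset.mul_sum]
    convert! hasSum_fintype _ using 2 with l
    rw [hatCol_diagOp, norm_smul, lp.norm_single (by norm_num)]
    simp [mul_pow]
  refine memℓp_gen ((summable_sigma_of_nonneg fun x => by positivity).2
    ⟨fun i => (hfib i).summable, ?_⟩)
  simp only [(hfib _).tsum_eq]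
  have hξ : Summable fun i => ‖ξ i‖ ^ 2 := by simpa using (hasSum_norm_sq ξ).summable
  refine Summable.of_nonneg_of_le (fun i => by positivity) (fun i => ?_)
    (hξ.mul_right (2 * ‖c‖ ^ 2))
  have := lp.norm_apply_le_norm (by simp) c i
  have h2 := sum_norm_col_sq_le (c i)
  gcongr
  exact h2.trans (by gcongr)

end DiagOp

/-! ### The bimodule, its module maps and self-duality -/

section Bimodule

variable [DecidableEq I]

/-- The Hilbert--Schmidt operators that are block diagonal, with each block determined by its
`0`-th column through `col`. -/
def colSpace (n : I → ℕ) [∀ i, NeZero (n i)] : Submodule ℂ (HS n) where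
  carrier := {v | ∀ j (l : Fin (n j)), v ⟨j, l⟩ = lp.single 2 j (col l (v ⟨j, 0⟩ j))}
  zero_mem' := by simp
  add_mem' {v w} hv hw j l := by
    rw [lp.coeFn_add, Pi.add_apply, Pi.add_apply, lp.coeFn_add, Pi.add_apply, map_add,
      lp.single_add, ← hv, ← hw]
  smul_mem' z v hv j l := by
    rw [lp.coeFn_smul, Pi.smul_apply, Pi.smul_apply, lp.coeFn_smul, Pi.smul_apply, map_smul,
      lp.single_smul, ← hv]

lemma mem_colSpace {v : HS n} :
    v ∈ colSpace n ↔ ∀ j (l : Fin (n j)), v ⟨j, l⟩ = lp.single 2 j (col l (v ⟨j, 0⟩ j)) :=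
  Iff.rfl

lemma isClosed_colSpace : IsClosed (colSpace n : Set (HS n)) := by
  have : (colSpace n : Set (HS n)) = ⋂ (j : I) (l : Fin (n j)),
      {v : HS n | v ⟨j, l⟩ = lp.single 2 j (col l (v ⟨j, 0⟩ j))} := by
    ext v
    simp [mem_colSpace]
  rw [this]
  have he : ∀ x : Idx n, Continuous fun v : HS n => v x := fun x =>
    (lp.evalCLM ℂ (fun _ : Idx n => Hil n) 2 x).continuous
  refine isClosed_iInter fun j => isClosed_iInter fun l => isClosed_eq (he _) ?_
  refine (lp.isometry_single j).continuous.comp ((col l).continuous.comp ?_)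
  exact (lp.evalCLM ℂ (fun i => EuclideanSpace ℂ (Fin (n i))) 2 j).continuous.comp (he _)

/-- On block-diagonal operators both actions of `M'` scale each block by a number, and `col` is
linear. -/
lemma isHSBimodule_colSpace : IsHSBimodule (colSpace n) := by
  refine ⟨isClosed_colSpace, fun v hv a ha b hb => ?_⟩
  have ha' := exists_actsBy_of_mem_comm ha
  have hb' := exists_actsBy_of_mem_comm hb
  set s : I → ℂ := fun i => a (basisVec n ⟨i, 0⟩) i 0
  set r : I → ℂ := fun i => b (basisVec n ⟨i, 0⟩) i 0
  have hr : ∀ i, ‖r i‖ ≤ ‖b‖ := norm_coeff_le b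
  have hmem : Memℓp (fun x : Idx n => r x.1 • a (v x)) 2 := by
    refine ((lp.memℓp v).norm.const_mul (‖b‖ * ‖a‖)).mono fun x => ?_
    rw [norm_smul, mul_assoc]
    exact mul_le_mul (hr _) (a.le_opNorm _) (norm_nonneg _) (norm_nonneg _)
  refine ⟨⟨_, hmem⟩, ?_, ?_⟩
  · rw [mem_colSpace]
    intro j l
    change r j • a (v ⟨j, l⟩) = lp.single 2 j (col l ((r j • a (v ⟨j, 0⟩)) j))
    rw [hv j l, ha'.apply_single, lp.coeFn_smul, Pi.smul_apply, ha', map_smul, map_smul,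
      lp.single_smul, lp.single_smul]
  · ext1 ξ
    simp only [mul_apply_eq_comp, hsOp_apply]
    rw [ContinuousLinearMap.map_tsum _ (summable_and_bound v (b ξ)).1.of_norm]
    refine tsum_congr fun x => ?_
    rw [map_smul, hb']
    simp [smul_smul, mul_comm]

lemma diagOp_mem_modS (c : lp (fun i => EuclideanSpace ℂ (Fin (n i))) ∞) :
    diagOp c ∈ modS (density n) (colSpace n) := by
  refine ⟨mem_nInv_density _, fun ξ => ⟨⟨_, memℓp_hatCol_diagOp c ξ⟩, ?_, fun _ => rfl⟩⟩
  rw [mem_colSpace]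
  intro j l
  change hatCol _ _ _ _ = lp.single 2 j (col l (hatCol (density n) (diagOp c) ξ ⟨j, 0⟩ j))
  simp [hatCol_diagOp]

/-- Applying `α̂` to the unit vectors of `ℓ²(I)` recovers the columns `c_j`, with norms at most
`‖α‖` because `p₀ ≤ 1`. -/
lemma exists_diagOp_eq_of_mem_modS {α : BH n} (hα : α ∈ modS (density n) (colSpace n)) :
    ∃ c, α = diagOp c := by
  choose v hv hvα using fun j : I => hα.2 (lp.single 2 j 1)
  have hval : ∀ j (l : Fin (n j)), v j ⟨j, l⟩ = (√(prob l) : ℂ) • α (basisVec n ⟨j, l⟩) := by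
    intro j l
    simp [hvα, hatCol_density]
  have hbdd : Memℓp (fun j => v j ⟨j, 0⟩ j) ∞ := by
    refine memℓp_infty ⟨‖α‖, ?_⟩
    rintro _ ⟨j, rfl⟩
    refine (lp.norm_apply_le_norm (by norm_num) _ _).trans ?_
    rw [hval, norm_smul, Complex.norm_of_nonneg (by positivity)]
    have h1 : √(prob (0 : Fin (n j))) ≤ 1 := Real.sqrt_le_one.2 (prob_le_one _)
    have h2 : ‖α (basisVec n ⟨j, 0⟩)‖ ≤ ‖α‖ := by simpa using α.le_opNorm (basisVec n ⟨j, 0⟩)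
    calc _ ≤ 1 * ‖α‖ := by gcongr
      _ = _ := one_mul _
  refine ⟨⟨_, hbdd⟩, ext_basisVec fun ⟨j, l⟩ => ?_⟩
  rw [diagOp_basisVec]
  change _ = _ • (lp.single 2 j (col l (v j ⟨j, 0⟩ j)) : Hil n)
  rw [← hv j j l, hval, smul_smul, mul_comm, ofReal_sqrt_mul_sqrt_inv, one_smul]

/-- The `0`-th columns of `t(δ_j)` are bounded by `‖t‖`, and for this `V` that alone makes `diagOp`
a bounded operator. -/
lemma exists_mem_modS_of_isModuleMap {t : Ell2 I →L[ℂ] HS n} (ht : IsModuleMap t)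
    (hV : ∀ ξ, t ξ ∈ colSpace n) :
    ∃ α ∈ modS (density n) (colSpace n), ∀ ξ x, t ξ x = hatCol (density n) α ξ x := by
  have hcol : ∀ (ξ : Ell2 I) j (l : Fin (n j)), t ξ ⟨j, l⟩ = ξ j • t (lp.single 2 j 1) ⟨j, l⟩ := by
    intro ξ j l
    -- Right multiplication by the `j`-th block projection turns `ξ` into `ξ_j δ_j`.
    have h := ht _ (actsBy_blockProj j).mem_comm _ (actsBy_blockProj j) ξ
      (ξ j • lp.single 2 j 1) (fun i => by
        by_cases h : i = j
        · subst h; simp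
        · simp [Pi.single_eq_of_ne h])
    have h2 := congrArg (fun T : BH n => T (basisVec n ⟨j, l⟩)) h
    simpa [blockProj_basisVec_same, hsOp_basisVec] using h2.symm
  have hbdd : Memℓp (fun j => t (lp.single 2 j 1) ⟨j, 0⟩ j) ∞ := by
    refine memℓp_infty ⟨‖t‖, ?_⟩
    rintro _ ⟨j, rfl⟩
    refine (lp.norm_apply_le_norm (by norm_num) _ _).trans ?_
    refine (lp.norm_apply_le_norm (by norm_num) _ _).trans ?_
    simpa [lp.norm_single] using t.le_opNorm (lp.single 2 j 1)
  refine ⟨diagOp ⟨_, hbdd⟩, diagOp_mem_modS _, fun ξ ⟨j, l⟩ => ?_⟩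
  rw [hatCol_diagOp, hcol, hV _ j l]

/-- Divide by the coefficients of the diagonal Gram form; being at least `1`, they do not increase
the norm. -/
lemma exists_inner_col_eq {m : ℕ} [NeZero m] (r : EuclideanSpace ℂ (Fin m)) :
    ∃ c : EuclideanSpace ℂ (Fin m), ‖c‖ ≤ ‖r‖ ∧
      ∀ d, ∑ l, ⟪col l c, col l d⟫_ℂ = ⟪r, d⟫_ℂ := by
  refine ⟨WithLp.toLp 2 fun l => (gramCoeff l : ℂ)⁻¹ * r l, ?_, fun d => ?_⟩
  · rw [EuclideanSpace.norm_eq, EuclideanSpace.norm_eq]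
    refine Real.sqrt_le_sqrt (Finset.sum_le_sum fun l _ => ?_)
    have h := one_le_gramCoeff l
    simp only [norm_mul, norm_inv, Complex.norm_of_nonneg (zero_le_one.trans h)]
    have : (gramCoeff l)⁻¹ ≤ 1 := inv_le_one_of_one_le₀ h
    have h0 : 0 ≤ (gramCoeff l)⁻¹ := by positivity
    gcongr
    exact mul_le_of_le_one_left (norm_nonneg _) this
  · rw [sum_inner_col, PiLp.inner_apply]
    refine Finset.sum_congr rfl fun l _ => ?_
    have h : (gramCoeff l : ℂ) ≠ 0 :=
      Complex.ofReal_ne_zero.2 (zero_lt_one.trans_le (one_le_gramCoeff l)).ne'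
    simp only [map_mul, map_inv₀, Complex.conj_ofReal, RCLike.inner_apply]
    field_simp

lemma isSelfDual_modS_colSpace : IsSelfDual (density n) (modS (density n) (colSpace n)) := by
  rintro F hF hadd hmul ⟨C, hC⟩
  have hsmul_comm : ∀ z : ℂ, (z • (1 : BH n)) ∈ comm n := fun z =>
    ActsBy.mem_comm (c := fun _ => z) fun ξ i => by simp
  have hbound : ∀ j (d : EuclideanSpace ℂ (Fin (n j))),
      ‖F (diagOp (lp.single ∞ j d)) (basisVec n ⟨j, 0⟩) j 0‖ ≤ √(2 * |C|) * ‖d‖ := by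
    intro j d
    refine (norm_coeff_le _ _).trans (abs_le_of_sq_le_sq' ?_ (by positivity)).2
    rw [mul_pow, Real.sq_sqrt (by positivity)]
    have h := modNormSq_diagOp_le (lp.single ∞ j d : lp (fun i => EuclideanSpace ℂ (Fin (n i))) ∞)
    rw [lp.norm_single (by simp)] at h
    have h0 : 0 ≤ modNormSq (density n) (diagOp (lp.single ∞ j d)) :=
      Real.iSup_nonneg fun i => norm_nonneg _
    calc _ ≤ C * _ := hC _ (diagOp_mem_modS _)
      _ ≤ |C| * (2 * ‖d‖ ^ 2) := mul_le_mul (le_abs_self C) h h0 (abs_nonneg C)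
      _ = _ := by ring
  -- `F` restricted to the `j`-th block is a functional on `ℂ^{n(j)}`, bounded uniformly in `j`.
  let L : ∀ j, EuclideanSpace ℂ (Fin (n j)) →L[ℂ] ℂ := fun j =>
    LinearMap.mkContinuous
      { toFun := fun d => F (diagOp (lp.single ∞ j d)) (basisVec n ⟨j, 0⟩) j 0
        map_add' := fun d d' => by
          rw [lp.single_add, diagOp_add, hadd _ (diagOp_mem_modS _) _ (diagOp_mem_modS _)]
          simp
        map_smul' := fun z d => by
          rw [lp.single_smul, diagOp_smul, hmul _ (diagOp_mem_modS _) _ (hsmul_comm z)]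
          simp }
      √(2 * |C|) (hbound j)
  have hL : ∀ j d, L j d = F (diagOp (lp.single ∞ j d)) (basisVec n ⟨j, 0⟩) j 0 :=
    fun j d => rfl
  have hLn : ∀ j, ‖L j‖ ≤ √(2 * |C|) := fun j =>
    LinearMap.mkContinuous_norm_le _ (by positivity) _
  choose c hc hcd using fun j => exists_inner_col_eq ((InnerProductSpace.toDual ℂ _).symm (L j))
  have hbdd : Memℓp c ∞ := by
    refine memℓp_infty ⟨√(2 * |C|), ?_⟩
    rintro _ ⟨j, rfl⟩
    refine (hc j).trans ?_
    rw [LinearIsometryEquiv.norm_map]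
    exact hLn j
  refine ⟨diagOp ⟨c, hbdd⟩, diagOp_mem_modS _, fun α hα => ?_⟩
  obtain ⟨d, rfl⟩ := exists_diagOp_eq_of_mem_modS hα
  convert exists_actsBy_of_mem_comm (hF _ hα) using 1
  ext i
  rw [modInner_diagOp]
  change ∑ l, ⟪col l (c i), col l (d i)⟫_ℂ = _
  -- Module linearity for the block projection shows that `F` is determined by its restrictions to
  -- the blocks.
  rw [hcd, InnerProductSpace.toDual_symm_apply, hL, ← diagOp_mul_blockProj,
    hmul _ hα _ (actsBy_blockProj i).mem_comm, mul_apply_eq_comp,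
    blockProj_basisVec_same]

end Bimodule

/-! ### Failure of integrability -/

section NotIntegrable

variable [DecidableEq I]

/-- The element of `colSpace n` whose block `j` has `0`-th column the `k`-th unit vector. -/
def colUnit (j : I) (k : Fin (n j)) : HS n :=
  lp.single 2 ⟨j, k⟩ ((√(prob k) : ℂ) • basisVec n ⟨j, 0⟩) +
    lp.single 2 ⟨j, 0⟩ (basisVec n ⟨j, k⟩)

lemma colUnit_mem_colSpace (j : I) {k : Fin (n j)} (hk : k ≠ 0) :
    colUnit j k ∈ colSpace n := by
  rw [mem_colSpace]
  intro i l
  by_cases hi : i = j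
  · subst hi
    have h0 : colUnit i k ⟨i, 0⟩ = basisVec n ⟨i, k⟩ := by
      simp [colUnit, hk.symm]
    rw [h0]
    by_cases hl : l = 0
    · subst hl
      rw [h0]
      simp [basisVec]
    · rw [col_of_ne hl, basisVec_apply_same]
      by_cases hlk : l = k
      · subst hlk
        have h1 : colUnit i l ⟨i, l⟩ = (√(prob l) : ℂ) • basisVec n ⟨i, 0⟩ := by
          simp [colUnit, hl]
        rw [h1, if_pos rfl, mul_one, lp.single_smul, basisVec]
      · simp [colUnit, hl, hlk]
  · simp [colUnit, hi]

lemma norm_colUnit_le (j : I) (k : Fin (n j)) : ‖colUnit j k‖ ≤ 2 := by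
  refine (norm_add_le _ _).trans ?_
  rw [lp.norm_single (by norm_num), lp.norm_single (by norm_num), norm_smul, norm_basisVec,
    norm_basisVec, Complex.norm_of_nonneg (by positivity)]
  have h1 : √(prob k) ≤ 1 := Real.sqrt_le_one.2 (prob_le_one _)
  linarith

lemma not_isIntegrable_of_range_eq_colSpace (hn : ¬ BddAbove (Set.range n))
    {e : HS n →L[ℂ] HS n} (he : IsStarProjection e)
    (hr : LinearMap.range e.toLinearMap = colSpace n) : ¬ IsIntegrable (density n) e := by
  rintro ⟨C, hC⟩
  have hsa : ∀ v w : HS n, ⟪v, e w⟫_ℂ = ⟪e v, w⟫_ℂ := fun v w => by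
    rw [← ContinuousLinearMap.adjoint_inner_left, ← ContinuousLinearMap.star_eq_adjoint,
      he.isSelfAdjoint.star_eq]
  have hidem : ∀ v, e (e v) = e v := fun v =>
    congrArg (fun T : HS n →L[ℂ] HS n => T v) he.isIdempotentElem.eq
  have hfix : ∀ v ∈ colSpace n, e v = v := by
    intro v hv
    rw [← hr] at hv
    obtain ⟨w, rfl⟩ := hv
    exact hidem w
  have hself : ∀ v, (⟪v, e v⟫_ℂ).re = ‖e v‖ ^ 2 := by
    intro v
    have h : ⟪v, e v⟫_ℂ = ⟪e v, e v⟫_ℂ := by rw [← hsa, hidem]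
    rw [h, inner_self_eq_norm_sq_to_K]
    norm_cast
  have hslice : ∀ j (k : Fin (n j)), k ≠ 0 →
      1 / 4 ≤ (prob k)⁻¹ * (slice e (basisVec n ⟨j, 0⟩) j k k).re := by
    intro j k hk
    have hp := prob_pos k
    simp only [slice, Matrix.of_apply, hself]
    set E : HS n := lp.single 2 (⟨j, k⟩ : Idx n) (basisVec n ⟨j, 0⟩)
    -- Pairing with one vector of `V` of norm at most `2` bounds `‖e E‖` from below without
    -- computing `e`.
    have h1 : ⟪colUnit j k, e E⟫_ℂ = √(prob k) := by
      rw [hsa, hfix _ (colUnit_mem_colSpace j hk), lp.inner_single_right]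
      simp [colUnit, hk]
    have h2 : √(prob k) ≤ 2 * ‖e E‖ := by
      calc √(prob k) = ‖⟪colUnit j k, e E⟫_ℂ‖ := by
            rw [h1, Complex.norm_of_nonneg (by positivity)]
        _ ≤ ‖colUnit j k‖ * ‖e E‖ := norm_inner_le_norm _ _
        _ ≤ _ := by gcongr; exact norm_colUnit_le j k
    have h3 : prob k ≤ 4 * ‖e E‖ ^ 2 := by
      rw [← Real.sq_sqrt hp.le]
      calc _ ≤ (2 * ‖e E‖) ^ 2 := by gcongr
        _ = _ := by ring
    rw [inv_mul_eq_div, le_div_iff₀ hp]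
    linarith
  have htrace : ∀ j, ((n j : ℝ) - 1) / 4 ≤
      (density n j * slice e (basisVec n ⟨j, 0⟩) j).trace.re := by
    intro j
    have hsum : (density n j * slice e (basisVec n ⟨j, 0⟩) j).trace.re =
        ∑ k, (prob k)⁻¹ * (slice e (basisVec n ⟨j, 0⟩) j k k).re := by
      simp [Matrix.trace, density, Matrix.diagonal_mul, ← Complex.ofReal_inv]
    rw [hsum]
    -- The term `k = 0` is discarded, hence `n j - 1`.
    have hpos : 0 ≤ (prob (0 : Fin (n j)))⁻¹ * (slice e (basisVec n ⟨j, 0⟩) j 0 0).re := by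
      have := prob_pos (0 : Fin (n j))
      simp only [slice, Matrix.of_apply, hself]
      positivity
    calc ((n j : ℝ) - 1) / 4 = ∑ k ∈ Finset.univ.erase (0 : Fin (n j)), (1 / 4 : ℝ) := by
          rw [Finset.sum_const, Finset.card_erase_of_mem (Finset.mem_univ _), Finset.card_univ,
            Fintype.card_fin, nsmul_eq_mul, Nat.cast_sub NeZero.one_le]
          push_cast
          ring
      _ ≤ ∑ k ∈ Finset.univ.erase (0 : Fin (n j)),
            (prob k)⁻¹ * (slice e (basisVec n ⟨j, 0⟩) j k k).re :=
          Finset.sum_le_sum fun k hk => hslice j k (Finset.ne_of_mem_erase hk)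
      _ ≤ _ := by
          rw [← Finset.add_sum_erase _ _ (Finset.mem_univ (0 : Fin (n j)))]
          linarith
  refine hn ⟨⌈4 * |C| + 1⌉₊, ?_⟩
  rintro _ ⟨j, rfl⟩
  have h := (ENNReal.le_tsum j).trans (hC (basisVec n ⟨j, 0⟩))
  rw [norm_basisVec, one_pow, mul_one, ENNReal.ofReal_le_ofReal_iff'] at h
  have hle : ((n j : ℝ) - 1) / 4 ≤ |C| := by
    -- `ENNReal.ofReal` truncates at zero, so the alternative is a nonpositive trace.
    rcases h with h | h
    · exact (htrace j).trans (h.trans (le_abs_self C))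
    · exact (htrace j).trans (h.trans (abs_nonneg C))
  have : (n j : ℝ) ≤ ⌈4 * |C| + 1⌉₊ := le_trans (by linarith) (Nat.le_ceil _)
  exact_mod_cast this

end NotIntegrable

end MatrixQG

end

theorem mainTheorem11 {I : Type*} [DecidableEq I] (n : I → ℕ) (hpos : ∀ i, 0 < n i)
    (hn : ¬ BddAbove (Set.range n)) :
    ∃ Q : ∀ i, Matrix (Fin (n i)) (Fin (n i)) ℂ,
      (∀ i, (Q i).PosDef) ∧ (∀ i, ((Q i)⁻¹).trace = 1) ∧ MatrixQG.InvWeightBounded Q ∧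
      ∃ V : Submodule ℂ (MatrixQG.HS n), MatrixQG.IsHSBimodule V ∧
        MatrixQG.IsSelfDual Q (MatrixQG.modS Q V) ∧
        (∀ t : MatrixQG.Ell2 I →L[ℂ] MatrixQG.HS n, MatrixQG.IsModuleMap t → (∀ ξ, t ξ ∈ V) →
          ∃ α ∈ MatrixQG.modS Q V, ∀ ξ x, t ξ x = MatrixQG.hatCol Q α ξ x) ∧
        ∃ e : MatrixQG.HS n →L[ℂ] MatrixQG.HS n, IsStarProjection e ∧
          LinearMap.range e.toLinearMap = V ∧ ¬ MatrixQG.IsIntegrable Q e := by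
  have : ∀ i, NeZero (n i) := fun i => ⟨(hpos i).ne'⟩
  have : CompleteSpace (MatrixQG.colSpace n) :=
    (MatrixQG.isClosed_colSpace (n := n)).completeSpace_coe
  exact ⟨MatrixQG.density n, MatrixQG.density_posDef, MatrixQG.trace_density_inv,
    ⟨1, fun T _ i => by simpa using MatrixQG.norm_invWeight_density_le T i⟩,
    MatrixQG.colSpace n, MatrixQG.isHSBimodule_colSpace, MatrixQG.isSelfDual_modS_colSpace,
    fun t ht hV => MatrixQG.exists_mem_modS_of_isModuleMap ht hV,
    (MatrixQG.colSpace n).starProjection, isStarProjection_starProjection,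
    Submodule.range_starProjection _,
    MatrixQG.not_isIntegrable_of_range_eq_colSpace hn isStarProjection_starProjection
      (Submodule.range_starProjection _)⟩
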